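/- A two-colored partition $p$ consists of finitely many points, arranged in an upper and a lower row and each colored white ($\circ$) or black ($\bullet$), together with a partition of the set of all points into blocks (either row, or both, may be empty). Denote by $\mathcal P^{\circ\bullet}$ the set of all two-colored partitions. A set $\mathcal C\subseteq\mathcal P^{\circ\bullet}$ is a category if it contains the two identity partitions (one upper and one lower point of the same color, in one block) and the two partitions with no upper points and two lower points of different colors in one block (colors $\circ\bullet$ and $\bullet\circ$), and if it is closed under tensor products (horizontal concatenation), involution (reflection at the horizontal axis) and composition of composable pairs (vertical concatenation along a row of equal length and coloring; the middle row and the blocks contained in it are erased). Let $s$ be the partition without upper points and with lower row $\circ\bullet$ whose two points are singleton blocks, and let $f$ be the partition without upper points and with lower row $\circ\bullet\circ\bullet$ whose four points form one block. A category $\mathcal C$ is non-hyperoctahedral if $s\in\mathcal C$ or $f\notin\mathcal C$. It is case $\mathcal O$ if $s\notin\mathcal C$ and $f\notin\mathcal C$, case $\mathcal B$ if $s\in\mathcal C$ and $f\notin\mathcal C$, and case $\mathcal S$ if $s\in\mathcal C$ and $f\in\mathcal C$. The normalized color of a lower point is its color; that of an upper point is the inverse of its color. For a set $S$ of points of $p$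 let $\sigma_p(S)$ be the number of points in $S$ of normalized color $\circ$ minus the number of those of normalized color $\bullet$. The points of $p$ are ordered cyclically: the lower row from left to right, then the upper row from right to left; $]\alpha,\beta[_p$ and $]\alpha,\beta]_p$ denote the intervals from $\alpha$ to $\beta$ in this order, without $\alpha$ and respectively without and with $\beta$. The color distance of points $\alpha\neq\beta$ is $$\delta_p(\alpha,\beta):=\sigma_p(]\alpha,\beta]_p)+\tfrac12\big(\sigma_p(\{\alpha\})-\sigma_p(\{\beta\})\big)\in\mathbb Z.$$ For a category $\mathcal C$ put $$V(\mathcal C):=\{\sigma_p(B)\mid p\in\mathcal C,\ B\text{ block of }p\},$$ $$L(\mathcal C):=\{\delta_p(\alpha_1,\alpha_2)\mid p\in\mathcal C,\ B\text{ block of }p,\ \alpha_1,\alpha_2\in B,\ \alpha_1\neq\alpha_2,\ ]\alpha_1,\alpha_2[_p\cap B=\emptyset,\ \sigma_p(\{\alpha_1,\alpha_2\})\neq0\}.$$ Write $\pm A:=A\cup(-A)$ for $A\subseteq\mathbb Z$. **Proposition.** Let $\mathcal C\subseteq\mathcal P^{\circ\bullet}$ be a non-hyperoctahedral category. (a) $V(\mathcal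 C)$ is one of $\{0\}$, $\pm\{0,2\}$, $\pm\{0,1\}$, $\pm\{0,1,2\}$, $\mathbb Z$. (b) If $\mathcal C$ is case $\mathcal O$, then $V(\mathcal C)=\pm\{0,2\}$ if $L(\mathcal C)\neq\emptyset$, and $V(\mathcal C)=\{0\}$ otherwise. (c) If $\mathcal C$ is case $\mathcal B$, then $V(\mathcal C)=\pm\{0,1,2\}$ if $L(\mathcal C)\neq\emptyset$, and $V(\mathcal C)=\pm\{0,1\}$ otherwise. (d) If $\mathcal C$ is case $\mathcal S$, then $L(\mathcal C)\neq\emptyset$ and $V(\mathcal C)=\mathbb Z$. -/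

import Mathlib

namespace TwoColored

/-- The two colors, white and black. -/
inductive Color where
  | white
  | black

/-- The inverse color. -/
def Color.bar : Color → Color
  | .white => .black
  | .black => .white

/-- White counts `1`, black counts `-1`. -/
def Color.sign : Color → ℤ
  | .white => 1
  | .black => -1

/-- A two-colored partition with `k` upper and `l` lower points (each row is numbered from left to
right): a coloring of the points and a partition of the set of all points, given as the
equivalence relation whose classes are the blocks. -/
structure RowPart (k l : ℕ) where
  upperColor : Fin k → Color
  lowerColor : Fin l → Color
  rel : Setoid (Fin k ⊕ Fin l)

/-- The set of all two-colored partitions, with any numbers of upper and lower points. -/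
abbrev AllPart : Type := Σ k : ℕ, Σ l : ℕ, RowPart k l

/-- A partition with given row sizes as an element of the set of all two-colored partitions. -/
def RowPart.bundle {k l : ℕ} (p : RowPart k l) : AllPart := ⟨k, l, p⟩

namespace RowPart

variable {k l m : ℕ}

/-! ### Category operations -/

/-- Splits the points of a horizontal concatenation into those of the left and those of the
right partition. -/
def splitPoint {k l m n : ℕ} :
    Fin (k + m) ⊕ Fin (l + n) ≃ (Fin k ⊕ Fin l) ⊕ (Fin m ⊕ Fin n) :=
  (Equiv.sumCongr finSumFinEquiv.symm finSumFinEquiv.symm).trans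
    (Equiv.sumSumSumComm (Fin k) (Fin m) (Fin l) (Fin n))

/-- The disjoint union of two equivalence relations. -/
def sumSetoid {α β : Type} (r : Setoid α) (s : Setoid β) : Setoid (α ⊕ β) where
  r := Sum.LiftRel r s
  iseqv :=
    { refl := by
        rintro (a | b)
        · exact .inl (r.refl a)
        · exact .inr (s.refl b)
      symm := by
        rintro _ _ (h | h)
        · exact .inl (r.symm h)
        · exact .inr (s.symm h)
      trans := by
        rintro _ _ _ (h | h) (h' | h')
        · exact .inl (r.trans h h')
        · exact .inr (s.trans h h') }

/-- The tensor product: `q` is placed to the right of `p`. -/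
def tensor {n : ℕ} {k l m : ℕ} (p : RowPart k l) (q : RowPart m n) : RowPart (k + m) (l + n) where
  upperColor := Fin.append p.upperColor q.upperColor
  lowerColor := Fin.append p.lowerColor q.lowerColor
  rel := (sumSetoid p.rel q.rel).comap splitPoint

/-- The involution: reflection at the horizontal axis. -/
def invol (p : RowPart k l) : RowPart l k where
  upperColor := p.lowerColor
  lowerColor := p.upperColor
  rel := p.rel.comap Sum.swap

/-- The relations on three rows of points (upper, middle, lower) which a partition of the first
two rows and a partition of the last two rows impose. -/
inductive StackRel (r : Setoid (Fin k ⊕ Fin l)) (s : Setoid (Fin l ⊕ Fin m)) :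
    Fin k ⊕ Fin l ⊕ Fin m → Fin k ⊕ Fin l ⊕ Fin m → Prop
  | top {a b : Fin k ⊕ Fin l} (h : r a b) :
      StackRel r s (Sum.map id Sum.inl a) (Sum.map id Sum.inl b)
  | bottom {a b : Fin l ⊕ Fin m} (h : s a b) :
      StackRel r s (Sum.inr a) (Sum.inr b)

/-- The composition of `p` (on top) with `q` (below): the two partitions are joined
along the lower row of `p` and the upper row of `q`, and then the middle row is erased (along
with all blocks that are contained in it). It is used only for composable pairs, that is, if the
lower row of `p` is colored like the upper row of `q`. -/
def comp (p : RowPart k l) (q : RowPart l m) : RowPart k m where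
  upperColor := p.upperColor
  lowerColor := q.lowerColor
  rel := (Relation.EqvGen.setoid (StackRel p.rel q.rel)).comap (Sum.map id Sum.inr)

/-! ### Particular partitions -/

/-- The identity partition of color `c`: one upper and one lower point, both of color `c`, in
one block. -/
def ident (c : Color) : RowPart 1 1 := ⟨![c], ![c], ⊤⟩

/-- Two lower points, of colors `c` and the inverse of `c`, in one block. -/
def pair (c : Color) : RowPart 0 2 := ⟨![], ![c, c.bar], ⊤⟩

/-- Two lower points, of colors white and black, each a singleton block. -/
def singletons : RowPart 0 2 := ⟨![], ![.white, .black], ⊥⟩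

/-- Four lower points, of colors white, black, white, black, in one block. -/
def fourBlock : RowPart 0 4 := ⟨![], ![.white, .black, .white, .black], ⊤⟩

/-! ### Cyclic order, color sum and color distance -/

/-- The blocks of a partition. -/
def blocks (p : RowPart k l) : Set (Set (Fin k ⊕ Fin l)) := p.rel.classes

/-- `1` for a point whose normalized color is white and `-1` for one whose normalized color is
black. The normalized color of a lower point is its color, that of an upper point is the
inverse of its color. -/
def pointSign (p : RowPart k l) : Fin k ⊕ Fin l → ℤ :=
  Sum.elim (fun i => (p.upperColor i).bar.sign) (fun j => (p.lowerColor j).sign)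

/-- The color sum of a set of points. -/
noncomputable def colorSum (p : RowPart k l) (S : Set (Fin k ⊕ Fin l)) : ℤ :=
  ∑ x, S.indicator p.pointSign x

/-- The position of a point in the cyclic (counter-clockwise) order: first the lower row from left
to right, then the upper row from right to left. -/
def pos : Fin k ⊕ Fin l → ℕ :=
  Sum.elim (fun i => l + (Fin.rev i : ℕ)) (fun j => (j : ℕ))

/-- The open interval from `a` to `b` in the cyclic order. -/
def openInterval (_p : RowPart k l) (a b : Fin k ⊕ Fin l) : Set (Fin k ⊕ Fin l) :=
  {x | (pos a < pos x ∧ pos x < pos b) ∨ (pos x < pos b ∧ pos b < pos a) ∨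
    (pos b < pos a ∧ pos a < pos x)}

/-- The interval from `a` to `b` in the cyclic order without `a` and with `b`; it is empty if
`a = b`. -/
def rightClosedInterval (p : RowPart k l) (a b : Fin k ⊕ Fin l) : Set (Fin k ⊕ Fin l) :=
  {x | x ≠ a ∧ (x ∈ p.openInterval a b ∨ x = b)}

/-- The color distance from `a` to `b`. The division is exact, as signs are `1` or `-1`. -/
noncomputable def colorDist (p : RowPart k l) (a b : Fin k ⊕ Fin l) : ℤ :=
  p.colorSum (p.rightClosedInterval a b) + (p.pointSign a - p.pointSign b) / 2

end RowPart

/-! ### Categories of two-colored partitions -/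

/-- A category of two-colored partitions: a set of two-colored partitions which contains the
identity partitions of both colors and the two lower pair partitions with different colors, and which
is closed under tensor products, involution and composition of composable pairs. -/
structure IsCategory (C : Set AllPart) : Prop where
  ident_mem : ∀ c : Color, (RowPart.ident c).bundle ∈ C
  pair_mem : ∀ c : Color, (RowPart.pair c).bundle ∈ C
  tensor_mem : ∀ {k l m n : ℕ} (p : RowPart k l) (q : RowPart m n),
    p.bundle ∈ C → q.bundle ∈ C → (p.tensor q).bundle ∈ C
  invol_mem : ∀ {k l : ℕ} (p : RowPart k l), p.bundle ∈ C → p.invol.bundle ∈ C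
  comp_mem : ∀ {k l m : ℕ} (p : RowPart k l) (q : RowPart l m), p.lowerColor = q.upperColor →
    p.bundle ∈ C → q.bundle ∈ C → (p.comp q).bundle ∈ C

/-- Non-hyperoctahedral: contains the two singletons or does not contain the block of four. -/
def IsNonHyperoctahedral (C : Set AllPart) : Prop :=
  RowPart.singletons.bundle ∈ C ∨ RowPart.fourBlock.bundle ∉ C

/-- Case `O`: neither the two singletons nor the block of four. -/
def IsCaseO (C : Set AllPart) : Prop :=
  RowPart.singletons.bundle ∉ C ∧ RowPart.fourBlock.bundle ∉ C

/-- Case `B`: the two singletons, but not the block of four. -/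
def IsCaseB (C : Set AllPart) : Prop :=
  RowPart.singletons.bundle ∈ C ∧ RowPart.fourBlock.bundle ∉ C

/-- Case `S`: both the two singletons and the block of four. -/
def IsCaseS (C : Set AllPart) : Prop :=
  RowPart.singletons.bundle ∈ C ∧ RowPart.fourBlock.bundle ∈ C

/-- The set of block color sums of the partitions in `S`. -/
def blockColorSums (S : Set AllPart) : Set ℤ :=
  {s | ∃ (k l : ℕ) (p : RowPart k l), p.bundle ∈ S ∧ ∃ B ∈ p.blocks, s = p.colorSum B}

/-- The set of color distances between any two subsequent legs of the same block with the same
normalized color in partitions in `S`. -/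
def sameColorDistances (S : Set AllPart) : Set ℤ :=
  {d | ∃ (k l : ℕ) (p : RowPart k l), p.bundle ∈ S ∧ ∃ B ∈ p.blocks, ∃ a ∈ B, ∃ b ∈ B, a ≠ b ∧
    p.openInterval a b ∩ B = ∅ ∧ p.colorSum {a, b} ≠ 0 ∧ d = p.colorDist a b}

/-- The symmetrization `A ∪ (-A)` of a set of integers. -/
def plusMinus (A : Set ℤ) : Set ℤ := {x | x ∈ A ∨ -x ∈ A}

end TwoColored

namespace TwoColored

/-! The two partitions `s` and `f` control the possible block sizes. Categories are closed under
rotation, that is, under moving an outermost point to the other row while inverting its color; this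
keeps the blocks. Hence any point can be made the only upper point of some partition of `C`.

If that point is a singleton block of `q`, the composition of `q` with its reflection has two
singletons, and a rotation of it is `s` (`singletons_mem`). If a block has three points, rotations
and two such compositions yield `f`, whatever the colors of the points (`fourBlock_mem`).
Contrapositively, without `f` all blocks have at most two points, and without `s` none has just one.

So if `f` is not in `C`, a block is a singleton with sum 1 or -1, or a pair with sum 0, 2 or -2
(`block_eq`). Singletons occur exactly when `s` is in `C`. Sums 2 and -2 occur exactly when some
pair has equal normalized colors, and such a pair is just what makes `L` nonempty. Involution
negates all sums, so every sum comes with its negative. This settles cases O and B.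

In case S, copies of `f` are glued into one long block of alternating colors (`oneBlock_mem`).
Composing with columns that are cut at the black points leaves a block of n white points
(`whiteBlock_mem`), so all integers occur; for n = 2 it also gives an element of `L`. -/

theorem Color.bar_bar (c : Color) : c.bar.bar = c := by cases c <;> rfl

theorem Color.sign_bar (c : Color) : c.bar.sign = -c.sign := by cases c <;> rfl

namespace RowPart

variable {k l m n : ℕ}

theorem ext_of {p q : RowPart k l} (hu : p.upperColor = q.upperColor)
    (hl : p.lowerColor = q.lowerColor) (hr : p.rel = q.rel) : p = q := by
  cases p; cases q; simp_all

/-- Row sizes such as `k + m` and `m + k` give different types, so equality is only meaningful for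
the bundled partitions. -/
theorem bundle_eq_of_cast {k' l' : ℕ} {p : RowPart k l} {q : RowPart k' l'} (hk : k = k')
    (hl : l = l') (hu : ∀ i, q.upperColor (Fin.cast hk i) = p.upperColor i)
    (hv : ∀ i, q.lowerColor (Fin.cast hl i) = p.lowerColor i)
    (hr : ∀ x y, q.rel (Sum.map (Fin.cast hk) (Fin.cast hl) x)
      (Sum.map (Fin.cast hk) (Fin.cast hl) y) ↔ p.rel x y) : p.bundle = q.bundle := by
  subst hk hl
  congr 1
  refine ext_of (funext fun i => (hu i).symm) (funext fun i => (hv i).symm) ?_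
  ext x y
  simpa using (hr x y).symm

/-! ### Tensor products -/

theorem splitPoint_left (a : Fin k ⊕ Fin l) :
    splitPoint (m := m) (n := n) (Sum.map (Fin.castAdd m) (Fin.castAdd n) a) = Sum.inl a := by
  rcases a with a | a <;> simp [splitPoint]

theorem splitPoint_right (a : Fin m ⊕ Fin n) :
    splitPoint (k := k) (l := l) (Sum.map (Fin.natAdd k) (Fin.natAdd l) a) = Sum.inr a := by
  rcases a with a | a <;> simp [splitPoint]

theorem tensor_rel_left {p : RowPart k l} {q : RowPart m n} {a b : Fin k ⊕ Fin l}
    (h : p.rel a b) : (p.tensor q).rel (Sum.map (Fin.castAdd m) (Fin.castAdd n) a)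
      (Sum.map (Fin.castAdd m) (Fin.castAdd n) b) := by
  change sumSetoid p.rel q.rel _ _
  rw [splitPoint_left, splitPoint_left]
  exact .inl h

theorem tensor_rel_right {p : RowPart k l} {q : RowPart m n} {a b : Fin m ⊕ Fin n}
    (h : q.rel a b) : (p.tensor q).rel (Sum.map (Fin.natAdd k) (Fin.natAdd l) a)
      (Sum.map (Fin.natAdd k) (Fin.natAdd l) b) := by
  change sumSetoid p.rel q.rel _ _
  rw [splitPoint_right, splitPoint_right]
  exact .inr h

theorem eq_left_or_right (x : Fin (k + m) ⊕ Fin (l + n)) :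
    (∃ a, x = Sum.map (Fin.castAdd m) (Fin.castAdd n) a) ∨
      ∃ a, x = Sum.map (Fin.natAdd k) (Fin.natAdd l) a := by
  rcases h : splitPoint x with a | a
  · refine .inl ⟨a, splitPoint.injective ?_⟩
    rw [h, splitPoint_left]
  · refine .inr ⟨a, splitPoint.injective ?_⟩
    rw [h, splitPoint_right]

theorem tensor_rel_iff_left {p : RowPart k l} {q : RowPart m n} {a b : Fin k ⊕ Fin l} :
    (p.tensor q).rel (Sum.map (Fin.castAdd m) (Fin.castAdd n) a)
      (Sum.map (Fin.castAdd m) (Fin.castAdd n) b) ↔ p.rel a b := by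
  refine ⟨fun h => ?_, tensor_rel_left⟩
  change sumSetoid p.rel q.rel _ _ at h
  rw [splitPoint_left, splitPoint_left] at h
  cases h; assumption

theorem tensor_rel_iff_right {p : RowPart k l} {q : RowPart m n} {a b : Fin m ⊕ Fin n} :
    (p.tensor q).rel (Sum.map (Fin.natAdd k) (Fin.natAdd l) a)
      (Sum.map (Fin.natAdd k) (Fin.natAdd l) b) ↔ q.rel a b := by
  refine ⟨fun h => ?_, tensor_rel_right⟩
  change sumSetoid p.rel q.rel _ _ at h
  rw [splitPoint_right, splitPoint_right] at h
  cases h; assumption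

theorem not_tensor_rel {p : RowPart k l} {q : RowPart m n} {a : Fin k ⊕ Fin l}
    {b : Fin m ⊕ Fin n} : ¬ (p.tensor q).rel (Sum.map (Fin.castAdd m) (Fin.castAdd n) a)
      (Sum.map (Fin.natAdd k) (Fin.natAdd l) b) := by
  intro h
  change sumSetoid p.rel q.rel _ _ at h
  rw [splitPoint_left, splitPoint_right] at h
  cases h

theorem tensor_rel_cases {p : RowPart k l} {q : RowPart m n} {x y : Fin (k + m) ⊕ Fin (l + n)}
    (h : (p.tensor q).rel x y) :
    (∃ a b, p.rel a b ∧ x = Sum.map (Fin.castAdd m) (Fin.castAdd n) a ∧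
      y = Sum.map (Fin.castAdd m) (Fin.castAdd n) b) ∨
    ∃ a b, q.rel a b ∧ x = Sum.map (Fin.natAdd k) (Fin.natAdd l) a ∧
      y = Sum.map (Fin.natAdd k) (Fin.natAdd l) b := by
  rcases eq_left_or_right x with ⟨a, rfl⟩ | ⟨a, rfl⟩ <;>
    rcases eq_left_or_right y with ⟨b, rfl⟩ | ⟨b, rfl⟩
  · exact .inl ⟨a, b, tensor_rel_iff_left.1 h, rfl, rfl⟩
  · exact (not_tensor_rel h).elim
  · exact (not_tensor_rel (Setoid.symm' _ h)).elim
  · exact .inr ⟨a, b, tensor_rel_iff_right.1 h, rfl, rfl⟩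

/-! ### Compositions -/

/-- The partition of the three rows of points that a composition restricts to its outer rows. -/
def stack (p : RowPart k l) (q : RowPart l m) : Setoid (Fin k ⊕ Fin l ⊕ Fin m) :=
  Relation.EqvGen.setoid (StackRel p.rel q.rel)

theorem comp_rel_iff {p : RowPart k l} {q : RowPart l m} {x y : Fin k ⊕ Fin m} :
    (p.comp q).rel x y ↔ stack p q (Sum.map id Sum.inr x) (Sum.map id Sum.inr y) := Iff.rfl

theorem stack_top {p : RowPart k l} {q : RowPart l m} {a b : Fin k ⊕ Fin l} (h : p.rel a b) :
    stack p q (Sum.map id Sum.inl a) (Sum.map id Sum.inl b) :=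
  Relation.EqvGen.rel _ _ (.top h)

theorem stack_bottom {p : RowPart k l} {q : RowPart l m} {a b : Fin l ⊕ Fin m} (h : q.rel a b) :
    stack p q (Sum.inr a) (Sum.inr b) :=
  Relation.EqvGen.rel _ _ (.bottom h)

theorem stack_le {p : RowPart k l} {q : RowPart l m} {t : Setoid (Fin k ⊕ Fin l ⊕ Fin m)}
    (ht : ∀ a b, p.rel a b → t (Sum.map id Sum.inl a) (Sum.map id Sum.inl b))
    (hb : ∀ a b, q.rel a b → t (Sum.inr a) (Sum.inr b)) : stack p q ≤ t := by
  refine Setoid.eqvGen_le ?_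
  rintro _ _ (h | h)
  · exact ht _ _ h
  · exact hb _ _ h

/-- Computes a composition by collapsing: `f` sends each point of the three rows to a label, and `g`
picks a representative of each label. If the generators respect labels, related labels have related
representatives and each point is related to its representative, then the generated relation is
equality of labels up to `r`. -/
theorem stack_eq_comap {α : Type*} {p : RowPart k l} {q : RowPart l m} {r : Setoid α}
    (f : Fin k ⊕ Fin l ⊕ Fin m → α) (g : α → Fin k ⊕ Fin l ⊕ Fin m)
    (ht : ∀ a b, p.rel a b → r (f (Sum.map id Sum.inl a)) (f (Sum.map id Sum.inl b)))
    (hb : ∀ a b, q.rel a b → r (f (Sum.inr a)) (f (Sum.inr b)))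
    (hg : ∀ a b, r a b → stack p q (g a) (g b)) (hfg : ∀ z, stack p q z (g (f z))) :
    stack p q = r.comap f := by
  refine le_antisymm (stack_le ht hb) fun {x y} h => ?_
  exact Setoid.trans' _ (hfg x) (Setoid.trans' _ (hg _ _ h) (Setoid.symm' _ (hfg y)))

/-! ### Reflection at the vertical axis -/

/-- Reflection at the vertical axis, with colors kept. -/
def reflect (p : RowPart k l) : RowPart k l where
  upperColor := p.upperColor ∘ Fin.rev
  lowerColor := p.lowerColor ∘ Fin.rev
  rel := p.rel.comap (Sum.map Fin.rev Fin.rev)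

theorem reflect_rel_iff {p : RowPart k l} {x y : Fin k ⊕ Fin l} : p.reflect.rel x y ↔
    p.rel (Sum.map Fin.rev Fin.rev x) (Sum.map Fin.rev Fin.rev y) := Iff.rfl

theorem map_rev_map_rev (x : Fin k ⊕ Fin l) :
    Sum.map Fin.rev Fin.rev (Sum.map Fin.rev Fin.rev x) = x := by
  rcases x with x | x <;> simp

theorem reflect_reflect (p : RowPart k l) : p.reflect.reflect = p := by
  refine ext_of ?_ ?_ ?_
  · ext i; simp [reflect]
  · ext i; simp [reflect]
  · ext x y
    rw [reflect_rel_iff, reflect_rel_iff, map_rev_map_rev, map_rev_map_rev]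

theorem reflect_comp_le (p : RowPart k l) (q : RowPart l m) :
    (p.reflect.comp q.reflect).rel ≤ (p.comp q).reflect.rel := by
  have h : stack p.reflect q.reflect ≤
      (stack p q).comap (Sum.map Fin.rev (Sum.map Fin.rev Fin.rev)) := by
    refine stack_le ?_ ?_
    · rintro a b h
      have := stack_top (q := q) (reflect_rel_iff.1 h)
      rcases a with a | a <;> rcases b with b | b <;> exact this
    · rintro a b h
      have := stack_bottom (p := p) (reflect_rel_iff.1 h)
      rcases a with a | a <;> rcases b with b | b <;> exact this
  intro x y hxy
  have := h hxy
  rcases x with x | x <;> rcases y with y | y <;> exact this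

/-- One inclusion suffices, since reflection is an involution: the other one is the same inclusion
for the reflected partitions. -/
theorem reflect_comp (p : RowPart k l) (q : RowPart l m) :
    (p.comp q).reflect = p.reflect.comp q.reflect := by
  refine ext_of rfl rfl (le_antisymm ?_ (reflect_comp_le p q))
  intro x y h
  have h' := reflect_comp_le p.reflect q.reflect (x := Sum.map Fin.rev Fin.rev x)
    (y := Sum.map Fin.rev Fin.rev y)
  rw [reflect_reflect, reflect_reflect, reflect_rel_iff, map_rev_map_rev, map_rev_map_rev] at h'
  exact h' h

theorem reflect_tensor_bundle (p : RowPart k l) (q : RowPart m n) :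
    (p.tensor q).reflect.bundle = (q.reflect.tensor p.reflect).bundle := by
  have hL : ∀ {k m : ℕ} (i : Fin k), Fin.cast (Nat.add_comm k m) (Fin.rev (Fin.castAdd m i)) =
      Fin.natAdd m i.rev := by
    intro k m i; ext; simp [Fin.val_rev]; omega
  have hR : ∀ {k m : ℕ} (i : Fin m), Fin.cast (Nat.add_comm k m) (Fin.rev (Fin.natAdd k i)) =
      Fin.castAdd k i.rev := by
    intro k m i; ext; simp [Fin.val_rev]; omega
  refine bundle_eq_of_cast (Nat.add_comm k m) (Nat.add_comm l n) ?_ ?_ ?_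
  · intro i
    obtain ⟨i, rfl⟩ := Fin.rev_surjective i
    refine Fin.addCases (fun i => ?_) (fun i => ?_) i
    · rw [hL]; simp [tensor, reflect]
    · rw [hR]; simp [tensor, reflect]
  · intro i
    obtain ⟨i, rfl⟩ := Fin.rev_surjective i
    refine Fin.addCases (fun i => ?_) (fun i => ?_) i
    · rw [hL]; simp [tensor, reflect]
    · rw [hR]; simp [tensor, reflect]
  · have hs : ∀ x : Fin (k + m) ⊕ Fin (l + n), ∃ y, x = Sum.map Fin.rev Fin.rev y := by
      rintro (x | x)
      · exact ⟨.inl x.rev, by simp⟩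
      · exact ⟨.inr x.rev, by simp⟩
    have hl : ∀ a : Fin k ⊕ Fin l, Sum.map (Fin.cast (Nat.add_comm k m))
        (Fin.cast (Nat.add_comm l n)) (Sum.map Fin.rev Fin.rev
          (Sum.map (Fin.castAdd m) (Fin.castAdd n) a)) =
        Sum.map (Fin.natAdd m) (Fin.natAdd n) (Sum.map Fin.rev Fin.rev a) := by
      rintro (a | a) <;> simp only [Sum.map_inl, Sum.map_inr, hL]
    have hr : ∀ a : Fin m ⊕ Fin n, Sum.map (Fin.cast (Nat.add_comm k m))
        (Fin.cast (Nat.add_comm l n)) (Sum.map Fin.rev Fin.rev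
          (Sum.map (Fin.natAdd k) (Fin.natAdd l) a)) =
        Sum.map (Fin.castAdd k) (Fin.castAdd l) (Sum.map Fin.rev Fin.rev a) := by
      rintro (a | a) <;> simp only [Sum.map_inl, Sum.map_inr, hR]
    have hrr : ∀ {k l : ℕ} (p : RowPart k l) (a b : Fin k ⊕ Fin l),
        p.reflect.rel (Sum.map Fin.rev Fin.rev a) (Sum.map Fin.rev Fin.rev b) ↔ p.rel a b := by
      intro k l p a b
      rw [reflect_rel_iff, map_rev_map_rev, map_rev_map_rev]
    intro x y
    obtain ⟨x, rfl⟩ := hs x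
    obtain ⟨y, rfl⟩ := hs y
    rw [hrr]
    rcases eq_left_or_right x with ⟨a, rfl⟩ | ⟨a, rfl⟩ <;>
      rcases eq_left_or_right y with ⟨b, rfl⟩ | ⟨b, rfl⟩
    · rw [hl, hl, tensor_rel_iff_right, tensor_rel_iff_left, hrr]
    · rw [hl, hr]
      exact iff_of_false (fun h => not_tensor_rel (Setoid.symm' _ h)) not_tensor_rel
    · rw [hl, hr]
      exact iff_of_false not_tensor_rel (fun h => not_tensor_rel (Setoid.symm' _ h))
    · rw [hr, hr, tensor_rel_iff_left, tensor_rel_iff_right, hrr]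

/-! ### Rotations -/

/-- Moves the rightmost lower point to the right end of the upper row. -/
def rotRightUp (p : RowPart k (l + 1)) : RowPart (k + 1) l where
  upperColor := Fin.snoc p.upperColor (p.lowerColor (Fin.last l)).bar
  lowerColor := fun j => p.lowerColor j.castSucc
  rel := p.rel.comap (Sum.elim (Fin.snoc (α := fun _ => Fin k ⊕ Fin (l + 1)) Sum.inl
    (Sum.inr (Fin.last l))) fun j => Sum.inr j.castSucc)

/-- Moves the rightmost upper point to the right end of the lower row. -/
def rotRightDown (p : RowPart (k + 1) l) : RowPart k (l + 1) := p.invol.rotRightUp.invol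

/-- Moves the leftmost lower point to the left end of the upper row. -/
def rotLeftUp (p : RowPart k (l + 1)) : RowPart (k + 1) l where
  upperColor := Fin.cons (p.lowerColor 0).bar p.upperColor
  lowerColor := fun j => p.lowerColor j.succ
  rel := p.rel.comap (Sum.elim (Fin.cons (α := fun _ => Fin k ⊕ Fin (l + 1)) (Sum.inr 0) Sum.inl)
    fun j => Sum.inr j.succ)

/-- Moves the leftmost upper point to the left end of the lower row. -/
def rotLeftDown (p : RowPart (k + 1) l) : RowPart k (l + 1) := p.invol.rotLeftUp.invol

theorem reflect_rotRightUp_reflect (p : RowPart k (l + 1)) :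
    p.reflect.rotRightUp.reflect = p.rotLeftUp := by
  refine ext_of ?_ ?_ ?_
  · ext i
    refine Fin.cases ?_ (fun i => ?_) i <;> simp [reflect, rotRightUp, rotLeftUp, Fin.rev_succ]
  · ext i
    simp [reflect, rotRightUp, rotLeftUp, Fin.rev_castSucc]
  · have h : ∀ x : Fin (k + 1) ⊕ Fin l, Sum.map Fin.rev Fin.rev
        (Sum.elim (Fin.snoc (α := fun _ => Fin k ⊕ Fin (l + 1)) Sum.inl
        (Sum.inr (Fin.last l))) (fun j => Sum.inr j.castSucc) (Sum.map Fin.rev Fin.rev x)) =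
        Sum.elim (Fin.cons (α := fun _ => Fin k ⊕ Fin (l + 1)) (Sum.inr 0) Sum.inl)
          (fun j => Sum.inr j.succ) x := by
      rintro (x | x)
      · refine Fin.cases ?_ (fun i => ?_) x <;> simp [Fin.rev_succ]
      · simp [Fin.rev_castSucc]
    ext x y
    change p.rel (Sum.map Fin.rev Fin.rev _) (Sum.map Fin.rev Fin.rev _) ↔ p.rel _ _
    rw [h, h]

/-! ### Diagonal partitions -/

/-- The partition with equally colored rows, in which opposite points are in one block if their
color is in `s`, and all other points are singletons. -/
def diag (s : Set Color) (c : Fin n → Color) : RowPart n n where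
  upperColor := c
  lowerColor := c
  rel :=
    { r := fun x y => x = y ∨ Sum.elim id id x = Sum.elim id id y ∧ c (Sum.elim id id x) ∈ s
      iseqv :=
        { refl := fun _ => .inl rfl
          symm := by
            rintro x y (h | h)
            · exact .inl h.symm
            · exact .inr ⟨h.1.symm, h.1 ▸ h.2⟩
          trans := by
            rintro x y z (rfl | h) (rfl | h')
            · exact .inl rfl
            · exact .inr h'
            · exact .inr h
            · exact .inr ⟨h.1.trans h'.1, h.2⟩ } }

theorem diag_rel_iff {s : Set Color} {c : Fin n → Color} {x y : Fin n ⊕ Fin n} :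
    (diag s c).rel x y ↔
      x = y ∨ Sum.elim id id x = Sum.elim id id y ∧ c (Sum.elim id id x) ∈ s := Iff.rfl

/-- Splitting off the last column reduces membership of diagonal partitions in a category to single
columns. -/
theorem diag_snoc (s : Set Color) (c : Fin n → Color) (d : Color) :
    diag s (Fin.snoc c d : Fin (n + 1) → Color) = (diag s c).tensor (diag s ![d]) := by
  have hc : (Fin.snoc c d : Fin (n + 1) → Color) = Fin.append c ![d] := by
    rw [Fin.append_right_eq_snoc]; rfl
  refine ext_of hc hc ?_
  rw [hc]
  have hl : ∀ a : Fin n ⊕ Fin n, Sum.elim id id (Sum.map (Fin.castAdd 1) (Fin.castAdd 1) a) =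
      Fin.castAdd 1 (Sum.elim id id a) := by rintro (a | a) <;> rfl
  have hr : ∀ a : Fin 1 ⊕ Fin 1, Sum.elim id id (Sum.map (Fin.natAdd n) (Fin.natAdd n) a) =
      Fin.natAdd n (Sum.elim id id a) := by rintro (a | a) <;> rfl
  have hlr : ∀ (a : Fin n ⊕ Fin n) (b : Fin 1 ⊕ Fin 1), Fin.castAdd 1 (Sum.elim id id a) ≠
      Fin.natAdd n (Sum.elim id id b) := by
    intro a b h
    have := congrArg Fin.val h
    simp at this
    omega
  ext x y
  rcases eq_left_or_right x with ⟨a, rfl⟩ | ⟨a, rfl⟩ <;>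
    rcases eq_left_or_right y with ⟨b, rfl⟩ | ⟨b, rfl⟩
  · rw [tensor_rel_iff_left, diag_rel_iff, diag_rel_iff, hl, hl, Fin.append_left,
      (Fin.castAdd_injective n 1).eq_iff, (Function.Injective.sumMap
        (Fin.castAdd_injective n 1) (Fin.castAdd_injective n 1)).eq_iff]
  · refine iff_of_false ?_ not_tensor_rel
    rw [diag_rel_iff, hl, hr]
    rintro (h | h)
    · exact hlr a b (by rw [← hl, ← hr, h])
    · exact hlr a b h.1
  · refine iff_of_false ?_ (fun h => not_tensor_rel (Setoid.symm' _ h))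
    rw [diag_rel_iff, hl, hr]
    rintro (h | h)
    · exact hlr b a (by rw [← hl, ← hr, h])
    · exact hlr b a h.1.symm
  · rw [tensor_rel_iff_right, diag_rel_iff, diag_rel_iff, hr, hr, Fin.append_right,
      (Fin.natAdd_injective 1 n).eq_iff, (Function.Injective.sumMap
        (Fin.natAdd_injective 1 n) (Fin.natAdd_injective 1 n)).eq_iff]

end RowPart

open RowPart

variable {C : Set AllPart} {k l m n : ℕ}

/-! ### Closure of categories under rotation -/

namespace IsCategory

/-- Serves to transfer closure under right rotations to left ones: the result for the right is
applied to this mirrored category, so `C` itself need not be closed under reflection. -/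
theorem reflect (hC : IsCategory C) : IsCategory {x | x.2.2.reflect.bundle ∈ C} where
  ident_mem c := by
    have : (RowPart.ident c).reflect = RowPart.ident c := by
      refine ext_of ?_ ?_ ?_
      · ext i; simp [RowPart.reflect, RowPart.ident]
      · ext i; simp [RowPart.reflect, RowPart.ident]
      · rfl
    change (RowPart.ident c).reflect.bundle ∈ C
    rw [this]
    exact hC.ident_mem c
  pair_mem c := by
    have : (RowPart.pair c).reflect = RowPart.pair c.bar := by
      refine ext_of ?_ ?_ ?_
      · ext i; exact i.elim0
      · ext i; fin_cases i <;> simp [RowPart.reflect, RowPart.pair, Color.bar_bar]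
      · rfl
    change (RowPart.pair c).reflect.bundle ∈ C
    rw [this]
    exact hC.pair_mem _
  tensor_mem p q hp hq := by
    change (p.tensor q).reflect.bundle ∈ C
    rw [reflect_tensor_bundle]
    exact hC.tensor_mem _ _ hq hp
  invol_mem p hp := by
    have : p.invol.reflect = p.reflect.invol := by
      refine ext_of rfl rfl ?_
      ext (x | x) (y | y) <;> rfl
    change p.invol.reflect.bundle ∈ C
    rw [this]
    exact hC.invol_mem p.reflect hp
  comp_mem p q h hp hq := by
    change (p.comp q).reflect.bundle ∈ C
    rw [reflect_comp]
    refine hC.comp_mem _ _ ?_ hp hq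
    simp only [RowPart.reflect, h]

theorem diag_mem (hC : IsCategory C) (s : Set Color)
    (hs : ∀ d : Color, (diag s ![d]).bundle ∈ C) (c : Fin n → Color) :
    (diag s c).bundle ∈ C := by
  induction n with
  | zero =>
    -- The empty partition arises from a pair glued to its reflection, as the closed loop in the
    -- middle row is erased.
    have h := hC.comp_mem _ _ rfl (hC.pair_mem .white) (hC.invol_mem _ (hC.pair_mem .white))
    have e : (RowPart.pair .white).comp (RowPart.pair .white).invol = diag s c := by
      refine ext_of ?_ ?_ ?_
      · ext i; exact i.elim0
      · ext i; exact i.elim0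
      · ext x; exact x.elim (fun i => i.elim0) (fun i => i.elim0)
    rwa [e] at h
  | succ n ih =>
    rw [← Fin.snoc_init_self c, diag_snoc]
    exact hC.tensor_mem _ _ (ih _) (hs _)

theorem diag_univ_mem (hC : IsCategory C) (c : Fin n → Color) :
    (diag Set.univ c).bundle ∈ C := by
  refine hC.diag_mem _ (fun d => ?_) c
  have : diag Set.univ ![d] = RowPart.ident d := by
    refine ext_of rfl rfl ?_
    ext x y
    exact iff_of_true (.inr ⟨Subsingleton.elim _ _, trivial⟩) trivial
  rw [this]
  exact hC.ident_mem d

/-- A new strand is placed to the right of `p`, and a cap below joins its lower end to the last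
lower point of `p`. The other lower points continue along identities, so the upper end of the strand
takes the place of the last lower point. -/
theorem rotRightUp_mem (hC : IsCategory C) {p : RowPart k (l + 1)} (hp : p.bundle ∈ C) :
    p.rotRightUp.bundle ∈ C := by
  set c := p.lowerColor (Fin.last l)
  set A := p.tensor (RowPart.ident c.bar)
  set B := (diag Set.univ fun j : Fin l => p.lowerColor j.castSucc).tensor
    (RowPart.pair c).invol
  have hAC : A.bundle ∈ C := hC.tensor_mem _ _ hp (hC.ident_mem _)
  have hBC : B.bundle ∈ C :=
    hC.tensor_mem _ _ (hC.diag_univ_mem _) (hC.invol_mem _ (hC.pair_mem _))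
  have hcol : A.lowerColor = B.upperColor := by
    change Fin.append p.lowerColor ![c.bar] =
      Fin.append (fun j : Fin l => p.lowerColor j.castSucc) ![c, c.bar]
    ext i
    refine Fin.lastCases ?_ (fun i => ?_) i
    · rw [Fin.append_right_eq_snoc, Fin.snoc_last]
      exact (Fin.append_right _ ![c, c.bar] 1).symm
    · rw [Fin.append_right_eq_snoc, Fin.snoc_castSucc]
      refine Fin.lastCases ?_ (fun i => ?_) i
      · exact (Fin.append_right (fun j : Fin l => p.lowerColor j.castSucc) ![c, c.bar] 0).symm
      · exact (Fin.append_left (fun j : Fin l => p.lowerColor j.castSucc) ![c, c.bar] i).symm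
  have h := hC.comp_mem A B hcol hAC hBC
  -- `f` traces each point of the three rows to the point of `p` whose strand it lies on; both ends
  -- of the new strand belong to the last lower point.
  let f : Fin (k + 1) ⊕ Fin (l + 1 + 1) ⊕ Fin l → Fin k ⊕ Fin (l + 1) :=
    Sum.elim (Fin.snoc (α := fun _ => Fin k ⊕ Fin (l + 1)) Sum.inl (Sum.inr (Fin.last l)))
      (Sum.elim (Fin.snoc (α := fun _ => Fin k ⊕ Fin (l + 1)) Sum.inr (Sum.inr (Fin.last l)))
        fun j => Sum.inr j.castSucc)
  have f1 : ∀ i : Fin k, f (.inl i.castSucc) = .inl i := fun i => by simp [f]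
  have f2 : f (.inl (Fin.last k)) = .inr (Fin.last l) := by simp [f]
  have f3 : ∀ j : Fin (l + 1), f (.inr (.inl j.castSucc)) = .inr j := fun i => by simp [f]
  have f4 : f (.inr (.inl (Fin.last (l + 1)))) = .inr (Fin.last l) := by simp [f]
  have f5 : ∀ j : Fin l, f (.inr (.inr j)) = .inr j.castSucc := fun i => rfl
  let g : Fin k ⊕ Fin (l + 1) → Fin (k + 1) ⊕ Fin (l + 1 + 1) ⊕ Fin l :=
    Sum.elim (fun i => .inl i.castSucc) fun j => .inr (.inl j.castSucc)
  have hmid : stack A B (.inr (.inl (Fin.last (l + 1)))) (.inr (.inl (Fin.last l).castSucc)) :=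
    stack_bottom (p := A) (tensor_rel_right (p := diag Set.univ fun j : Fin l =>
      p.lowerColor j.castSucc) (q := (RowPart.pair c).invol) (a := .inl 1) (b := .inl 0) trivial)
  have key : stack A B = p.rel.comap f := by
    refine stack_eq_comap f g ?_ ?_ ?_ ?_
    · intro a b hx
      rcases tensor_rel_cases hx with ⟨a, b, hab, rfl, rfl⟩ | ⟨a, b, -, rfl, rfl⟩
      · have hf : ∀ a : Fin k ⊕ Fin (l + 1), f (Sum.map id Sum.inl
            (Sum.map (Fin.castAdd 1) (Fin.castAdd 1) a)) = a := by
          rintro (a | a)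
          · exact f1 a
          · exact f3 a
        rwa [hf, hf]
      · have hf : ∀ a : Fin 1 ⊕ Fin 1, f (Sum.map id Sum.inl
            (Sum.map (Fin.natAdd k) (Fin.natAdd (l + 1)) a)) = .inr (Fin.last l) := by
          rintro (a | a)
          · rw [Subsingleton.elim a 0]; exact f2
          · rw [Subsingleton.elim a 0]; exact f4
        rw [hf, hf]
    · intro a b hx
      rcases tensor_rel_cases hx with ⟨a, b, hab, rfl, rfl⟩ | ⟨a, b, -, rfl, rfl⟩
      · have hf : ∀ a : Fin l ⊕ Fin l, f (.inr (Sum.map (Fin.castAdd 2) (Fin.castAdd 0) a)) =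
            .inr (Sum.elim id id a).castSucc := by
          rintro (a | a)
          · exact f3 a.castSucc
          · exact f5 a
        rw [hf, hf]
        rcases hab with rfl | ⟨hab, -⟩
        · exact p.rel.refl' _
        · rw [hab]
      · have hf : ∀ a : Fin 2 ⊕ Fin 0, f (.inr (Sum.map (Fin.natAdd l) (Fin.natAdd l) a)) =
            .inr (Fin.last l) := by
          rintro (a | a)
          · fin_cases a
            · exact f3 (Fin.last l)
            · exact f4
          · exact a.elim0
        rw [hf, hf]
    · intro a b hab
      have hg : ∀ a, g a = Sum.map id Sum.inl (Sum.map (Fin.castAdd 1) (Fin.castAdd 1) a) := by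
        rintro (a | a) <;> rfl
      rw [hg, hg]
      exact stack_top (tensor_rel_left hab)
    · rintro (i | i | i)
      · refine Fin.lastCases ?_ (fun i => ?_) i
        · rw [f2]
          refine Setoid.trans' _ ?_ hmid
          exact stack_top (tensor_rel_right (p := p) (q := RowPart.ident c.bar)
            (a := .inl 0) (b := .inr 0) trivial)
        · rw [f1]; exact Setoid.refl' _ _
      · refine Fin.lastCases ?_ (fun i => ?_) i
        · rw [f4]
          exact hmid
        · rw [f3]; exact Setoid.refl' _ _
      · rw [f5]
        exact stack_bottom (tensor_rel_left (p := diag Set.univ fun j : Fin l =>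
          p.lowerColor j.castSucc) (a := .inr i) (b := .inl i) (.inr ⟨rfl, trivial⟩))
  have e : A.comp B = p.rotRightUp := by
    refine ext_of ?_ ?_ ?_
    · exact Fin.append_right_eq_snoc p.upperColor ![c.bar]
    · ext j
      exact Fin.append_left (fun j : Fin l => p.lowerColor j.castSucc) ![] j
    · ext x y
      rw [comp_rel_iff, key]
      rcases x with x | x <;> rcases y with y | y <;> rfl
  rw [← e]
  exact h

theorem rotRightDown_mem (hC : IsCategory C) {p : RowPart (k + 1) l} (hp : p.bundle ∈ C) :
    p.rotRightDown.bundle ∈ C :=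
  hC.invol_mem _ (hC.rotRightUp_mem (hC.invol_mem _ hp))

theorem rotLeftUp_mem (hC : IsCategory C) {p : RowPart k (l + 1)} (hp : p.bundle ∈ C) :
    p.rotLeftUp.bundle ∈ C := by
  rw [← reflect_rotRightUp_reflect]
  refine hC.reflect.rotRightUp_mem (p := p.reflect) ?_
  change p.reflect.reflect.bundle ∈ C
  rwa [reflect_reflect]

theorem rotLeftDown_mem (hC : IsCategory C) {p : RowPart (k + 1) l} (hp : p.bundle ∈ C) :
    p.rotLeftDown.bundle ∈ C :=
  hC.invol_mem _ (hC.rotLeftUp_mem (hC.invol_mem _ hp))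

end IsCategory

/-! ### Points under rotations -/

namespace RowPart

/-- The point of `p` that a point of `p.rotRightUp` comes from. -/
def rightUpMap : Fin (k + 1) ⊕ Fin l → Fin k ⊕ Fin (l + 1) :=
  Sum.elim (Fin.snoc (α := fun _ => Fin k ⊕ Fin (l + 1)) Sum.inl (Sum.inr (Fin.last l)))
    fun j => Sum.inr j.castSucc

/-- The point of `p` that a point of `p.rotLeftUp` comes from. -/
def leftUpMap : Fin (k + 1) ⊕ Fin l → Fin k ⊕ Fin (l + 1) :=
  Sum.elim (Fin.cons (α := fun _ => Fin k ⊕ Fin (l + 1)) (Sum.inr 0) Sum.inl)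
    fun j => Sum.inr j.succ

/-- The point of `p` that a point of `p.rotLeftDown` comes from. -/
def leftDownMap (x : Fin k ⊕ Fin (l + 1)) : Fin (k + 1) ⊕ Fin l := (leftUpMap x.swap).swap

theorem rightUpMap_last : rightUpMap (.inl (Fin.last k) : Fin (k + 1) ⊕ Fin l) =
    .inr (Fin.last l) := by simp [rightUpMap]

theorem rightUpMap_castSucc (i : Fin k) : rightUpMap (.inl i.castSucc : Fin (k + 1) ⊕ Fin l) =
    .inl i := by simp [rightUpMap]

theorem rotRightUp_rel_iff {p : RowPart k (l + 1)} {x y : Fin (k + 1) ⊕ Fin l} :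
    p.rotRightUp.rel x y ↔ p.rel (rightUpMap x) (rightUpMap y) := Iff.rfl

theorem rotLeftUp_rel_iff {p : RowPart k (l + 1)} {x y : Fin (k + 1) ⊕ Fin l} :
    p.rotLeftUp.rel x y ↔ p.rel (leftUpMap x) (leftUpMap y) := Iff.rfl

theorem rightUpMap_bijective : Function.Bijective (rightUpMap (k := k) (l := l)) := by
  rw [Fintype.bijective_iff_surjective_and_card]
  refine ⟨?_, by simp; omega⟩
  rintro (i | j)
  · exact ⟨.inl i.castSucc, rightUpMap_castSucc i⟩
  · refine Fin.lastCases ?_ (fun j => ?_) j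
    · exact ⟨_, rightUpMap_last⟩
    · exact ⟨.inr j, rfl⟩

theorem leftUpMap_bijective : Function.Bijective (leftUpMap (k := k) (l := l)) := by
  rw [Fintype.bijective_iff_surjective_and_card]
  refine ⟨?_, by simp; omega⟩
  rintro (i | j)
  · exact ⟨.inl i.succ, rfl⟩
  · refine Fin.cases ?_ (fun j => ?_) j
    · exact ⟨.inl 0, rfl⟩
    · exact ⟨.inr j, rfl⟩

theorem leftDownMap_bijective : Function.Bijective (leftDownMap (k := k) (l := l)) :=
  (Equiv.sumComm _ _).bijective.comp
    (leftUpMap_bijective.comp (Equiv.sumComm (Fin k) (Fin (l + 1))).bijective)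

end RowPart

/-! ### Rotating a given point into the upper row -/

namespace IsCategory

theorem exists_rotation_lower (hC : IsCategory C) {p : RowPart k l} (hp : p.bundle ∈ C) :
    ∃ (n : ℕ) (q : RowPart 0 n) (f : Fin 0 ⊕ Fin n → Fin k ⊕ Fin l), q.bundle ∈ C ∧
      Function.Bijective f ∧ q.rel = p.rel.comap f := by
  induction k generalizing l with
  | zero => exact ⟨l, p, id, hp, Function.bijective_id, rfl⟩
  | succ k ih =>
    obtain ⟨n, q, f, hq, hf, hr⟩ := ih (hC.rotLeftDown_mem hp)
    exact ⟨n, q, leftDownMap ∘ f, hq, leftDownMap_bijective.comp hf, by rw [hr]; rfl⟩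

/-- Moving the rightmost lower point up and then down on the left shifts the row cyclically by one.
After `d` shifts the chosen point is rightmost and is moved up. Only the blocks are tracked. -/
theorem exists_rotation_of_lower (hC : IsCategory C) (d : ℕ) {p : RowPart 0 (l + 1)}
    (hp : p.bundle ∈ C) (j : Fin (l + 1)) (hj : (j : ℕ) + d = l) :
    ∃ (n : ℕ) (q : RowPart 1 n) (f : Fin 1 ⊕ Fin n → Fin 0 ⊕ Fin (l + 1)), q.bundle ∈ C ∧
      Function.Bijective f ∧ f (.inl 0) = .inr j ∧ q.rel = p.rel.comap f := by
  induction d generalizing p j with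
  | zero =>
    obtain rfl : j = Fin.last l := Fin.ext (by simpa using hj)
    exact ⟨l, p.rotRightUp, rightUpMap, hC.rotRightUp_mem hp, rightUpMap_bijective,
      rightUpMap_last, rfl⟩
  | succ d ih =>
    obtain ⟨i, rfl⟩ : ∃ i : Fin l, j = i.castSucc := ⟨⟨j, by omega⟩, rfl⟩
    obtain ⟨n, q, f, hq, hf, h0, hr⟩ := ih (hC.rotLeftDown_mem (hC.rotRightUp_mem hp)) i.succ
      (by simp at hj ⊢; omega)
    refine ⟨n, q, rightUpMap ∘ leftDownMap ∘ f, hq,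
      rightUpMap_bijective.comp (leftDownMap_bijective.comp hf), ?_, by rw [hr]; rfl⟩
    simp only [Function.comp_apply, h0]
    rfl

/-- Every partition can be rotated such that a given point is its only upper point. -/
theorem exists_rotation (hC : IsCategory C) {p : RowPart k l} (hp : p.bundle ∈ C)
    (x : Fin k ⊕ Fin l) :
    ∃ (n : ℕ) (q : RowPart 1 n) (f : Fin 1 ⊕ Fin n → Fin k ⊕ Fin l), q.bundle ∈ C ∧
      Function.Bijective f ∧ f (.inl 0) = x ∧ q.rel = p.rel.comap f := by
  obtain ⟨n, q, f, hq, hf, hr⟩ := hC.exists_rotation_lower hp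
  obtain ⟨i | j, rfl⟩ := hf.surjective x
  · exact i.elim0
  cases n with
  | zero => exact j.elim0
  | succ n =>
    obtain ⟨n', q', f', hq', hf', h0, hr'⟩ :=
      hC.exists_rotation_of_lower (n - j) hq j (by omega)
    exact ⟨n', q', f ∘ f', hq', hf.comp hf', by simp [h0], by rw [hr', hr]; rfl⟩

/-! ### Singleton blocks -/

/-- The color decides on which side the upper point is moved down, so that white comes first. -/
theorem singletons_mem_of_bot (hC : IsCategory C) {q : RowPart 1 1} (hq : q.bundle ∈ C)
    (hc : q.lowerColor = q.upperColor) (hr : q.rel = ⊥) : singletons.bundle ∈ C := by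
  rcases hu : q.upperColor 0 with _ | _
  · have : q.rotRightDown = singletons := by
      refine ext_of ?_ ?_ ?_
      · ext i; exact i.elim0
      · have h0 : q.rotRightDown.lowerColor = Fin.snoc q.lowerColor (q.upperColor 0).bar := rfl
        rw [h0, hc, hu]
        ext i
        fin_cases i
        · exact hu
        · rfl
      · change ((q.rel.comap Sum.swap).comap rightUpMap).comap Sum.swap = ⊥
        rw [hr]
        ext x y
        change (rightUpMap x.swap).swap = (rightUpMap y.swap).swap ↔ x = y
        rw [Sum.swap_rightInverse.injective.eq_iff, rightUpMap_bijective.injective.eq_iff,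
          Sum.swap_rightInverse.injective.eq_iff]
    rw [← this]
    exact hC.rotRightDown_mem hq
  · have : q.rotLeftDown = singletons := by
      refine ext_of ?_ ?_ ?_
      · ext i; exact i.elim0
      · have h0 : q.rotLeftDown.lowerColor = Fin.cons (q.upperColor 0).bar q.lowerColor := rfl
        rw [h0, hc, hu]
        ext i
        fin_cases i
        · rfl
        · exact hu
      · change q.rel.comap leftDownMap = ⊥
        rw [hr]
        ext x y
        exact leftDownMap_bijective.injective.eq_iff
    rw [← this]
    exact hC.rotLeftDown_mem hq

/-- With the singleton as the only upper point of `q`, the composition of `q` and its reflection has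
one point in each row, equally colored and not connected. -/
theorem singletons_mem (hC : IsCategory C) {p : RowPart k l} (hp : p.bundle ∈ C)
    (x : Fin k ⊕ Fin l) (hx : ∀ y, p.rel x y → y = x) : singletons.bundle ∈ C := by
  obtain ⟨n, q, f, hq, hf, rfl, hr⟩ := hC.exists_rotation hp x
  have h0 : ∀ y, q.rel (.inl 0) y → y = .inl 0 := by
    intro y hy
    rw [hr] at hy
    exact hf.injective (hx _ hy)
  refine hC.singletons_mem_of_bot (hC.comp_mem q q.invol rfl hq (hC.invol_mem _ hq)) rfl ?_
  -- The classes of `t` are the top point and everything else. The top point is isolated in `q` and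
  -- absent from `q.invol`, so both respect `t`.
  let t : Setoid (Fin 1 ⊕ Fin n ⊕ Fin 1) := Setoid.ker fun z => z = .inl 0
  have ht : stack q q.invol ≤ t := by
    refine stack_le ?_ ?_
    · rintro (a | a) (b | b) h
      · rw [Subsingleton.elim a b]
      · rw [Subsingleton.elim a 0] at h
        cases h0 _ h
      · rw [Subsingleton.elim b 0] at h
        cases h0 _ (Setoid.symm' _ h)
      · simp [t, Setoid.ker_def]
    · intro a b _
      simp [t, Setoid.ker_def]
  ext x y
  refine ⟨fun h => ?_, fun h => h ▸ Setoid.refl' _ _⟩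
  have := ht (comp_rel_iff.1 h)
  rcases x with x | x <;> rcases y with y | y
  · rw [Subsingleton.elim x y]
  · simp [t, Setoid.ker_def, Subsingleton.elim x 0] at this
  · simp [t, Setoid.ker_def, Subsingleton.elim y 0] at this
  · rw [Subsingleton.elim x y]

/-! ### Blocks with at least three points -/

theorem fourBlock_mem_of_top (hC : IsCategory C) {q : RowPart 2 2} (hq : q.bundle ∈ C)
    (hc : q.lowerColor = q.upperColor) (hu : q.upperColor 1 = (q.upperColor 0).bar)
    (hr : ∀ x y, q.rel x y) : fourBlock.bundle ∈ C := by
  rcases h0 : q.upperColor 0 with _ | _ <;> rw [h0] at hu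
  · have : q.rotLeftDown.rotLeftDown = fourBlock := by
      refine ext_of ?_ ?_ ?_
      · ext i; exact i.elim0
      · have h : q.rotLeftDown.rotLeftDown.lowerColor =
          Fin.cons (q.upperColor 1).bar (Fin.cons (q.upperColor 0).bar q.lowerColor) := rfl
        rw [h, hc, h0, hu]
        ext i
        fin_cases i
        · rfl
        · rfl
        · exact h0
        · exact hu
      · ext x y
        exact iff_of_true (hr _ _) trivial
    rw [← this]
    exact hC.rotLeftDown_mem (hC.rotLeftDown_mem hq)
  · have : q.rotLeftDown.rotRightDown = fourBlock := by
      refine ext_of ?_ ?_ ?_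
      · ext i; exact i.elim0
      · have h : q.rotLeftDown.rotRightDown.lowerColor =
          Fin.snoc (Fin.cons (q.upperColor 0).bar q.lowerColor : Fin 3 → Color)
            (q.upperColor 1).bar := rfl
        rw [h, hc, h0, hu]
        ext i
        fin_cases i
        · rfl
        · exact h0
        · exact hu
        · rfl
      · ext x y
        exact iff_of_true (hr _ _) trivial
    rw [← this]
    exact hC.rotRightDown_mem (hC.rotLeftDown_mem hq)

/-- Lower points are moved up on the left until `a` has moved; `b`, lying to the right of `a`, is
still below then. The induction runs over the position of `a`. -/
theorem exists_split_block (hC : IsCategory C) {p : RowPart (k + 1) l} (hp : p.bundle ∈ C)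
    (i : ℕ) (a b : Fin l) (ha : (a : ℕ) = i) (hab : a < b)
    (h1 : p.rel (.inl (Fin.last k)) (.inr a)) (h2 : p.rel (.inl (Fin.last k)) (.inr b)) :
    ∃ (k l : ℕ) (q : RowPart (k + 2) l) (s : Fin (k + 1)) (t : Fin l), q.bundle ∈ C ∧
      q.rel (.inl (Fin.last (k + 1))) (.inl s.castSucc) ∧
      q.rel (.inl (Fin.last (k + 1))) (.inr t) := by
  induction i generalizing k l with
  | zero =>
    cases l with
    | zero => exact a.elim0
    | succ l =>
      obtain rfl : a = 0 := Fin.ext ha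
      obtain ⟨b, rfl⟩ := Fin.exists_succ_eq.2 hab.ne'
      exact ⟨k, l, p.rotLeftUp, 0, b, hC.rotLeftUp_mem hp, h1, h2⟩
  | succ i ih =>
    cases l with
    | zero => exact a.elim0
    | succ l =>
      obtain ⟨a, rfl⟩ := Fin.exists_succ_eq.2 (show a ≠ 0 by rintro rfl; simp at ha)
      obtain ⟨b, rfl⟩ := Fin.exists_succ_eq.2 (show b ≠ 0 by rintro rfl; simp at hab)
      exact ih (hC.rotLeftUp_mem hp) a b (by simpa using ha) (by simpa using hab) h1 h2

/-- The remaining upper points are moved down on the left, which does not affect the last two. -/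
theorem exists_two_upper (hC : IsCategory C) {p : RowPart (k + 2) l} (hp : p.bundle ∈ C)
    (t : Fin l) (hc : p.upperColor (Fin.last (k + 1)) =
      (p.upperColor (Fin.last k).castSucc).bar)
    (h1 : p.rel (.inl (Fin.last (k + 1))) (.inl (Fin.last k).castSucc))
    (h2 : p.rel (.inl (Fin.last (k + 1))) (.inr t)) :
    ∃ (l : ℕ) (q : RowPart 2 l) (t : Fin l), q.bundle ∈ C ∧
      q.upperColor 1 = (q.upperColor 0).bar ∧ q.rel (.inl 1) (.inl 0) ∧
      q.rel (.inl 1) (.inr t) := by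
  induction k generalizing l with
  | zero => exact ⟨l, p, t, hp, hc, h1, h2⟩
  | succ k ih => exact ih (hC.rotLeftDown_mem hp) t.succ hc h1 h2

/-- The colors of the three given points are arbitrary, so a neighboring pair of inverse colors has
to be made first. In `e`, the composition of `q` with its reflection, the last points of both rows
have equal color and are connected through `t`. Moving the lower one up puts it beside the other one
with inverse color, while `s` keeps the block connected to the lower row. A second composition with
a reflection then joins two such pairs. -/
theorem fourBlock_mem_of_rotated (hC : IsCategory C) {p : RowPart 1 n} (hp : p.bundle ∈ C)
    {a b : Fin n} (hab : a < b) (h1 : p.rel (.inl 0) (.inr a)) (h2 : p.rel (.inl 0) (.inr b)) :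
    fourBlock.bundle ∈ C := by
  obtain ⟨k, l, q, s, t, hq, hs, ht⟩ := hC.exists_split_block (k := 0) hp a a b rfl hab h1 h2
  have he := hC.comp_mem q q.invol rfl hq (hC.invol_mem _ hq)
  set e := q.comp q.invol
  have e1 : stack q q.invol (.inl (Fin.last (k + 1))) (.inr (.inl t)) := stack_top ht
  have e2 : stack q q.invol (.inr (.inr (Fin.last (k + 1)))) (.inr (.inl t)) :=
    stack_bottom (q := q.invol) (a := .inr (Fin.last (k + 1))) (b := .inl t) ht
  have e3 : stack q q.invol (.inr (.inr (Fin.last (k + 1)))) (.inr (.inr s.castSucc)) :=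
    stack_bottom (q := q.invol) (a := .inr (Fin.last (k + 1))) (b := .inr s.castSucc) hs
  obtain ⟨l', g, t', hg, hgc, hg1, hg2⟩ := hC.exists_two_upper (hC.rotRightUp_mem he) s
    (by
      change (Fin.snoc e.upperColor (e.lowerColor (Fin.last (k + 1))).bar : Fin (k + 3) → Color)
        (Fin.last (k + 2)) = ((Fin.snoc e.upperColor (e.lowerColor (Fin.last (k + 1))).bar :
          Fin (k + 3) → Color) (Fin.last (k + 1)).castSucc).bar
      rw [Fin.snoc_last, Fin.snoc_castSucc]
      rfl)
    (by
      rw [rotRightUp_rel_iff, rightUpMap_last, rightUpMap_castSucc]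
      exact Setoid.trans' (stack q q.invol) e2 (Setoid.symm' _ e1))
    (by
      rw [rotRightUp_rel_iff, rightUpMap_last]
      exact e3)
  refine hC.fourBlock_mem_of_top (hC.comp_mem g g.invol rfl hg (hC.invol_mem _ hg)) rfl hgc ?_
  have hg3 : g.rel (.inl 0) (.inr t') := Setoid.trans' _ (Setoid.symm' _ hg1) hg2
  -- All four outer points are connected to the middle point `t'`.
  have hall : ∀ x : Fin 2 ⊕ Fin 2, stack g g.invol (Sum.map id Sum.inr x) (.inr (.inl t')) := by
    rintro (x | x)
    · refine stack_top (a := .inl x) (b := .inr t') ?_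
      fin_cases x
      · exact hg3
      · exact hg2
    · refine stack_bottom (a := .inr x) (b := .inl t') ?_
      fin_cases x
      · exact hg3
      · exact hg2
  exact fun x y => Setoid.trans' (stack g g.invol) (hall x) (Setoid.symm' _ (hall y))

theorem fourBlock_mem (hC : IsCategory C) {p : RowPart k l} (hp : p.bundle ∈ C)
    {x y z : Fin k ⊕ Fin l} (hxy : x ≠ y) (hxz : x ≠ z) (hyz : y ≠ z) (h1 : p.rel x y)
    (h2 : p.rel x z) : fourBlock.bundle ∈ C := by
  obtain ⟨n, q, f, hq, hf, rfl, hr⟩ := hC.exists_rotation hp x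
  obtain ⟨y, rfl⟩ := hf.surjective y
  obtain ⟨z, rfl⟩ := hf.surjective z
  replace h1 : q.rel (.inl 0) y := by rw [hr]; exact h1
  replace h2 : q.rel (.inl 0) z := by rw [hr]; exact h2
  rcases y with y | y
  · exact (hxy (by rw [Subsingleton.elim y 0])).elim
  rcases z with z | z
  · exact (hxz (by rw [Subsingleton.elim z 0])).elim
  rcases lt_trichotomy y z with h | rfl | h
  · exact hC.fourBlock_mem_of_rotated hq h h1 h2
  · exact (hyz rfl).elim
  · exact hC.fourBlock_mem_of_rotated hq h h2 h1

end IsCategory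

/-! ### Color sums -/

namespace RowPart

theorem colorSum_coe (p : RowPart k l) (s : Finset (Fin k ⊕ Fin l)) :
    p.colorSum s = ∑ x ∈ s, p.pointSign x :=
  Finset.sum_indicator_subset _ (Finset.subset_univ s)

theorem colorSum_singleton (p : RowPart k l) (x : Fin k ⊕ Fin l) :
    p.colorSum {x} = p.pointSign x := by
  simpa using p.colorSum_coe {x}

theorem colorSum_pair (p : RowPart k l) {x y : Fin k ⊕ Fin l} (h : x ≠ y) :
    p.colorSum {x, y} = p.pointSign x + p.pointSign y := by
  simpa [Finset.sum_pair h] using p.colorSum_coe {x, y}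

theorem pointSign_eq (p : RowPart k l) (x : Fin k ⊕ Fin l) :
    p.pointSign x = 1 ∨ p.pointSign x = -1 := by
  have h : ∀ c : Color, c.sign = 1 ∨ c.sign = -1 := by rintro (_ | _) <;> simp [Color.sign]
  rcases x with x | x <;> exact h _

theorem pointSign_invol (p : RowPart k l) (x : Fin k ⊕ Fin l) :
    p.invol.pointSign x.swap = -p.pointSign x := by
  rcases x with x | x
  · change (p.upperColor x).sign = -(p.upperColor x).bar.sign
    rw [Color.sign_bar, neg_neg]
  · exact Color.sign_bar _

theorem colorSum_invol (p : RowPart k l) (S : Set (Fin k ⊕ Fin l)) :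
    p.invol.colorSum (Sum.swap ⁻¹' S) = -p.colorSum S := by
  rw [colorSum, colorSum, ← Finset.sum_neg_distrib]
  refine (Fintype.sum_equiv (Equiv.sumComm (Fin k) (Fin l)) _ _ fun x => ?_).symm
  by_cases hx : x ∈ S
  · rw [Set.indicator_of_mem hx, Set.indicator_of_mem (by simpa using hx)]
    exact (p.pointSign_invol x).symm
  · rw [Set.indicator_of_notMem hx, Set.indicator_of_notMem (by simpa using hx), neg_zero]

theorem rel_of_mem_block {p : RowPart k l} {B : Set (Fin k ⊕ Fin l)} (hB : B ∈ p.blocks)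
    {x y : Fin k ⊕ Fin l} (hx : x ∈ B) (hy : y ∈ B) : p.rel x y := by
  obtain ⟨z, rfl⟩ := hB
  exact Setoid.trans' _ hx (Setoid.symm' _ hy)

theorem exists_mem_block {p : RowPart k l} {B : Set (Fin k ⊕ Fin l)} (hB : B ∈ p.blocks) :
    ∃ x, x ∈ B ∧ ∀ y, p.rel x y → y ∈ B := by
  obtain ⟨z, rfl⟩ := hB
  exact ⟨z, Setoid.refl' _ _, fun y hy => Setoid.symm' _ hy⟩

end RowPart

namespace IsCategory

/-- Swapping the rows inverts every normalized color and keeps the blocks. -/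
theorem neg_mem_blockColorSums (hC : IsCategory C) {v : ℤ} (hv : v ∈ blockColorSums C) :
    -v ∈ blockColorSums C := by
  obtain ⟨k, l, p, hp, B, ⟨x, rfl⟩, rfl⟩ := hv
  refine ⟨l, k, p.invol, hC.invol_mem p hp, Sum.swap ⁻¹' {y | p.rel y x}, ⟨x.swap, ?_⟩,
    (p.colorSum_invol _).symm⟩
  ext y
  change p.rel y.swap x ↔ p.rel y.swap x.swap.swap
  rw [Sum.swap_swap]

theorem zero_mem_blockColorSums (hC : IsCategory C) : 0 ∈ blockColorSums C := by
  refine ⟨0, 2, RowPart.pair .white, hC.pair_mem _, Set.univ, ⟨.inr 0, ?_⟩, ?_⟩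
  · exact (Set.eq_univ_of_forall fun x => trivial).symm
  · simp [colorSum, pointSign, RowPart.pair, Color.sign, Color.bar]

theorem one_mem_blockColorSums (h : singletons.bundle ∈ C) : 1 ∈ blockColorSums C := by
  refine ⟨0, 2, singletons, h, {.inr 0}, ⟨.inr 0, rfl⟩, ?_⟩
  rw [colorSum_singleton]
  rfl

/-! ### Categories without blocks of more than two points -/

/-- A third point in a block would force `f` into the category, and a lone point forces `s`; the
latter is recorded for use in case O. -/
theorem block_eq (hC : IsCategory C) (hf : fourBlock.bundle ∉ C) {p : RowPart k l}
    (hp : p.bundle ∈ C) {B : Set (Fin k ⊕ Fin l)} (hB : B ∈ p.blocks) :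
    (∃ x, B = {x} ∧ singletons.bundle ∈ C) ∨ ∃ x y, x ≠ y ∧ B = {x, y} := by
  obtain ⟨x, hx, hxB⟩ := exists_mem_block hB
  by_cases h : ∃ y ∈ B, y ≠ x
  · obtain ⟨y, hy, hyx⟩ := h
    refine .inr ⟨x, y, hyx.symm, Set.Subset.antisymm (fun z hz => ?_) ?_⟩
    · by_contra hz'
      rw [Set.mem_insert_iff, Set.mem_singleton_iff, not_or] at hz'
      exact hf (hC.fourBlock_mem hp hyx.symm (Ne.symm hz'.1) (Ne.symm hz'.2)
        (rel_of_mem_block hB hx hy) (rel_of_mem_block hB hx hz))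
    · rintro z (rfl | rfl)
      · exact hx
      · exact hy
  · push Not at h
    refine .inl ⟨x, Set.Subset.antisymm (fun z hz => h z hz) ?_, ?_⟩
    · rintro z rfl
      exact hx
    · exact hC.singletons_mem hp x fun y hy => h y (hxB y hy)

theorem eq_of_mem_blockColorSums (hC : IsCategory C) (hf : fourBlock.bundle ∉ C) {v : ℤ}
    (hv : v ∈ blockColorSums C) :
    v = 0 ∨ (v = 1 ∨ v = -1) ∧ singletons.bundle ∈ C ∨
      (v = 2 ∨ v = -2) ∧ sameColorDistances C ≠ ∅ := by
  obtain ⟨k, l, p, hp, B, hB, rfl⟩ := hv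
  rcases hC.block_eq hf hp hB with ⟨x, rfl, hs⟩ | ⟨x, y, hxy, rfl⟩
  · rw [colorSum_singleton]
    exact .inr (.inl ⟨p.pointSign_eq x, hs⟩)
  · by_cases h0 : p.colorSum {x, y} = 0
    · exact .inl h0
    · refine .inr (.inr ⟨?_, ?_⟩)
      · rw [colorSum_pair _ hxy] at h0 ⊢
        have hx := p.pointSign_eq x
        have hy := p.pointSign_eq y
        omega
      · refine Set.nonempty_iff_ne_empty.1 ⟨p.colorDist x y, k, l, p, hp, _, hB, x, by simp, y,
          by simp, hxy, ?_, h0, rfl⟩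
        refine Set.eq_empty_of_forall_notMem ?_
        rintro z ⟨hz, rfl | rfl⟩ <;> simp [openInterval] at hz <;> omega

/-- The two legs behind an element of `L` already form the whole block, so its sum is 2 or -2, and
the sign can be changed. -/
theorem two_mem_blockColorSums (hC : IsCategory C) (hf : fourBlock.bundle ∉ C)
    (hL : sameColorDistances C ≠ ∅) : 2 ∈ blockColorSums C := by
  obtain ⟨d, k, l, p, hp, B, hB, a, ha, b, hb, hab, -, h0, -⟩ := Set.nonempty_iff_ne_empty.2 hL
  have hBab : B = {a, b} := by
    rcases hC.block_eq hf hp hB with ⟨x, rfl, -⟩ | ⟨x, y, hxy, rfl⟩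
    · exact (hab (ha.trans hb.symm)).elim
    · rcases ha with rfl | rfl <;> rcases hb with rfl | rfl
      · exact (hab rfl).elim
      · rfl
      · exact Set.pair_comm _ _
      · exact (hab rfl).elim
  have hm : p.colorSum {a, b} ∈ blockColorSums C := ⟨k, l, p, hp, B, hB, by rw [hBab]⟩
  have hn := hC.neg_mem_blockColorSums hm
  rw [colorSum_pair _ hab] at h0 hm hn
  rcases p.pointSign_eq a with h1 | h1 <;> rcases p.pointSign_eq b with h2 | h2 <;>
    rw [h1, h2] at h0 hm hn
  · exact hm
  · exact (h0 rfl).elim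
  · exact (h0 rfl).elim
  · exact hn

end IsCategory

/-! ### Categories with singletons and blocks of more than two points -/

/-- The alternating coloring of a row, beginning with white. -/
def altColor (n : ℕ) (i : Fin n) : Color := if Even (i : ℕ) then .white else .black

/-- The partition with one block and without upper points. -/
def oneBlock (c : Fin n → Color) : RowPart 0 n := ⟨Fin.elim0, c, ⊤⟩

/-- The partition without upper points whose white points are in one block and whose black points
are singletons. -/
def whiteBlock (c : Fin n → Color) : RowPart 0 n := (oneBlock c).comp (diag {.white} c)

theorem whiteBlock_rel_iff {c : Fin n → Color} {i j : Fin n} :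
    (whiteBlock c).rel (.inr i) (.inr j) ↔ i = j ∨ c i = .white ∧ c j = .white := by
  classical
  -- The label `none` stands for the long block, made of the middle row and the white lower points;
  -- each black lower point has its own label.
  let t : Setoid (Fin 0 ⊕ Fin n ⊕ Fin n) := Setoid.ker
    (Sum.elim (fun _ => none) (Sum.elim (fun _ => none)
      fun j => if c j = .white then none else some j) : Fin 0 ⊕ Fin n ⊕ Fin n → Option (Fin n))
  constructor
  · intro h
    have ht : stack (oneBlock c) (diag {.white} c) ≤ t := by
      refine stack_le ?_ ?_
      · rintro (a | a) (b | b) -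
        all_goals first | exact a.elim0 | exact b.elim0 | rfl
      · rintro a b (rfl | ⟨h, h'⟩)
        · exact Setoid.refl' _ _
        · have hc : c (Sum.elim id id b) = .white := by rw [← h]; exact h'
          rcases a with a | a <;> rcases b with b | b <;>
            simp_all [t, Setoid.ker_def]
    have := ht (comp_rel_iff.1 h)
    simp only [t, Setoid.ker_def, Sum.map_inr, Sum.elim_inr] at this
    split_ifs at this with h1 h2
    · exact .inr ⟨h1, h2⟩
    · exact .inl (Option.some.inj this)
  · rintro (rfl | ⟨hi, hj⟩)
    · exact Setoid.refl' _ _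
    · have hw : ∀ i, c i = .white → stack (oneBlock c) (diag {.white} c) (.inr (.inr i))
          (.inr (.inl i)) := fun i hi =>
        stack_bottom (p := oneBlock c) (q := diag {.white} c) (a := .inr i) (b := .inl i)
          (.inr ⟨rfl, hi⟩)
      have hm : stack (oneBlock c) (diag {.white} c) (.inr (.inl i)) (.inr (.inl j)) :=
        stack_top (p := oneBlock c) (a := .inr i) (b := .inr j) trivial
      exact Setoid.trans' (stack (oneBlock c) (diag {.white} c)) (hw i hi)
        (Setoid.trans' _ hm (Setoid.symm' _ (hw j hj)))

theorem whiteBlock_mem_blocks {c : Fin n → Color} (i : Fin n) (hi : c i = .white) :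
    {x | Sum.elim Fin.elim0 c x = .white} ∈ (whiteBlock c).blocks := by
  refine ⟨.inr i, ?_⟩
  ext (x | x)
  · exact x.elim0
  · change c x = .white ↔ (whiteBlock c).rel (.inr x) (.inr i)
    rw [whiteBlock_rel_iff]
    refine ⟨fun h => .inr ⟨h, hi⟩, ?_⟩
    rintro (rfl | h)
    · exact hi
    · exact h.1

theorem colorSum_whiteBlock (n : ℕ) : (whiteBlock (altColor (2 * n))).colorSum
    {x | Sum.elim Fin.elim0 (altColor (2 * n)) x = .white} = n := by
  have h : ∀ i : Fin (2 * n), Set.indicator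
      {x | Sum.elim Fin.elim0 (altColor (2 * n)) x = .white}
      (whiteBlock (altColor (2 * n))).pointSign (.inr i) = if Even (i : ℕ) then 1 else 0 := by
    intro i
    by_cases hi : Even (i : ℕ)
    · rw [Set.indicator_of_mem (by simp [altColor, hi]), if_pos hi]
      change (altColor (2 * n) i).sign = 1
      simp [altColor, hi, Color.sign]
    · rw [Set.indicator_of_notMem (by simp [altColor, hi]), if_neg hi]
  have hsum : ∀ n : ℕ, ∑ i ∈ Finset.range (2 * n), (if Even i then (1 : ℤ) else 0) = n := by
    intro n
    induction n with
    | zero => simp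
    | succ n ih =>
      rw [Nat.mul_succ, Finset.sum_range_succ, Finset.sum_range_succ, ih]
      simp [parity_simps]
  rw [colorSum, Fintype.sum_sum_type, Finset.univ_eq_empty, Finset.sum_empty, zero_add,
    Finset.sum_congr rfl fun i _ => h i,
    Fin.sum_univ_eq_sum_range (fun i => if Even i then (1 : ℤ) else 0), hsum]

namespace IsCategory

/-- A white column is an identity; a black one, with its two points disconnected, is `s` with its
white point moved up. -/
theorem diag_white_mem (hC : IsCategory C) (hs : singletons.bundle ∈ C) (c : Fin n → Color) :
    (diag {.white} c).bundle ∈ C := by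
  refine hC.diag_mem _ ?_ c
  rintro (_ | _)
  · have : diag {.white} ![Color.white] = RowPart.ident .white := by
      refine ext_of rfl rfl ?_
      ext x y
      exact iff_of_true (.inr ⟨Subsingleton.elim _ _, by simp⟩) trivial
    rw [this]
    exact hC.ident_mem _
  · have : diag {.white} ![Color.black] = singletons.rotLeftUp := by
      refine ext_of ?_ ?_ ?_
      · ext i; fin_cases i; rfl
      · ext i; fin_cases i; rfl
      · ext x y
        rw [diag_rel_iff, rotLeftUp_rel_iff]
        change _ ↔ leftUpMap x = leftUpMap y
        rw [leftUpMap_bijective.injective.eq_iff]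
        simp
    rw [this]
    exact hC.rotLeftUp_mem hs

/-- The length is written to split off the last point, which is black. In the induction step it is
glued to `f` with its first point moved up, which replaces it by three points colored black, white,
black of the same block. -/
theorem oneBlock_mem (hC : IsCategory C) (hf : fourBlock.bundle ∈ C) (n : ℕ) :
    (oneBlock (altColor (2 * n + 1 + 1))).bundle ∈ C := by
  induction n with
  | zero =>
    have : RowPart.pair .white = oneBlock (altColor 2) := by
      refine ext_of (by ext i; exact i.elim0) ?_ rfl
      ext i; fin_cases i <;> simp [RowPart.pair, oneBlock, altColor, Color.bar]
    rw [Nat.mul_zero, ← this]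
    exact hC.pair_mem _
  | succ n ih =>
    set A := oneBlock (altColor (2 * n + 1 + 1))
    set B := (diag Set.univ (altColor (2 * n + 1))).tensor fourBlock.rotLeftUp
    have hB : B.bundle ∈ C := hC.tensor_mem _ _ (hC.diag_univ_mem _) (hC.rotLeftUp_mem hf)
    have hcol : A.lowerColor = B.upperColor := by
      change altColor (2 * n + 1 + 1) =
        Fin.append (altColor (2 * n + 1)) fourBlock.rotLeftUp.upperColor
      ext i
      refine Fin.addCases (m := 2 * n + 1) (n := 1) (fun i => ?_) (fun i => ?_) i
      · rw [Fin.append_left]; rfl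
      · rw [Fin.append_right, Subsingleton.elim i 0]
        change _ = Color.black
        simp [altColor, parity_simps]
    have h := hC.comp_mem A B hcol ih hB
    have e : A.comp B = oneBlock (altColor (2 * (n + 1) + 1 + 1)) := by
      refine ext_of (by ext i; exact i.elim0) ?_ ?_
      · change Fin.append (altColor (2 * n + 1)) ![Color.black, Color.white, Color.black] =
          altColor (2 * n + 1 + 3)
        ext i
        refine Fin.addCases (fun i => ?_) (fun i => ?_) i
        · rw [Fin.append_left]; rfl
        · rw [Fin.append_right]
          fin_cases i <;> simp [altColor, parity_simps]
      · have hm : ∀ i j, stack A B (.inr (.inl i)) (.inr (.inl j)) := fun i j =>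
          stack_top (p := A) (a := .inr i) (b := .inr j) trivial
        have hl : ∀ j : Fin (2 * n + 1 + 3), stack A B (.inr (.inr j)) (.inr (.inl 0)) := by
          intro j
          refine Fin.addCases (fun j => ?_) (fun j => ?_) j
          · refine Setoid.trans' _ (stack_bottom (p := A)
              (tensor_rel_left (a := .inr j) (b := .inl j) ?_)) (hm _ _)
            exact .inr ⟨rfl, trivial⟩
          · exact Setoid.trans' _ (stack_bottom (p := A)
              (tensor_rel_right (a := .inr j) (b := .inl 0) trivial)) (hm _ _)
        ext x y
        refine iff_of_true ?_ trivial
        rcases x with x | x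
        · exact x.elim0
        rcases y with y | y
        · exact y.elim0
        exact Setoid.trans' (stack A B) (hl x) (Setoid.symm' _ (hl y))
    rw [← e]
    exact h

theorem whiteBlock_mem (hC : IsCategory C) (hs : singletons.bundle ∈ C)
    (hf : fourBlock.bundle ∈ C) (n : ℕ) :
    (whiteBlock (altColor (2 * (n + 1)))).bundle ∈ C :=
  hC.comp_mem _ _ rfl (hC.oneBlock_mem hf n) (hC.diag_white_mem hs _)

theorem blockColorSums_eq_univ (hC : IsCategory C) (hs : singletons.bundle ∈ C)
    (hf : fourBlock.bundle ∈ C) : blockColorSums C = Set.univ := by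
  have h : ∀ n : ℕ, (n : ℤ) ∈ blockColorSums C := by
    rintro (_ | n)
    · exact hC.zero_mem_blockColorSums
    · exact ⟨0, _, _, hC.whiteBlock_mem hs hf n, _, whiteBlock_mem_blocks 0 (by simp [altColor]),
        (colorSum_whiteBlock (n + 1)).symm⟩
  refine Set.eq_univ_of_forall fun v => ?_
  obtain ⟨n, rfl | rfl⟩ := v.eq_nat_or_neg
  · exact h n
  · exact hC.neg_mem_blockColorSums (h n)

theorem sameColorDistances_ne_empty (hC : IsCategory C) (hs : singletons.bundle ∈ C)
    (hf : fourBlock.bundle ∈ C) : sameColorDistances C ≠ ∅ := by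
  -- Among four alternating points, those at positions 0 and 2 are white and in one block; the point
  -- between them is a black singleton.
  refine Set.nonempty_iff_ne_empty.1 ⟨_, 0, 4, _, hC.whiteBlock_mem hs hf 1, _,
    whiteBlock_mem_blocks 0 (by simp [altColor]), .inr 0, ?_, .inr 2, ?_, ?_, ?_, ?_, rfl⟩
  · simp [altColor]
  · simp [altColor]
  · simp
  · refine Set.eq_empty_of_forall_notMem ?_
    rintro (x | x) ⟨h1, h2⟩
    · exact x.elim0
    · fin_cases x <;> simp [openInterval, pos, altColor] at h1 h2
  · rw [colorSum_pair _ (by simp)]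
    change (altColor 4 0).sign + (altColor 4 2).sign ≠ 0
    simp [altColor, Color.sign]

end IsCategory

end TwoColored

/-! ### The proposition -/

theorem proposition5p1 (C : Set TwoColored.AllPart) (hC : TwoColored.IsCategory C)
    (hN : TwoColored.IsNonHyperoctahedral C) :
    (TwoColored.blockColorSums C = {0} ∨
      TwoColored.blockColorSums C = TwoColored.plusMinus {0, 2} ∨
      TwoColored.blockColorSums C = TwoColored.plusMinus {0, 1} ∨
      TwoColored.blockColorSums C = TwoColored.plusMinus {0, 1, 2} ∨
      TwoColored.blockColorSums C = Set.univ) ∧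
    (TwoColored.IsCaseO C →
      (TwoColored.sameColorDistances C ≠ ∅ →
        TwoColored.blockColorSums C = TwoColored.plusMinus {0, 2}) ∧
      (TwoColored.sameColorDistances C = ∅ → TwoColored.blockColorSums C = {0})) ∧
    (TwoColored.IsCaseB C →
      (TwoColored.sameColorDistances C ≠ ∅ →
        TwoColored.blockColorSums C = TwoColored.plusMinus {0, 1, 2}) ∧
      (TwoColored.sameColorDistances C = ∅ →
        TwoColored.blockColorSums C = TwoColored.plusMinus {0, 1})) ∧
    (TwoColored.IsCaseS C →
      TwoColored.sameColorDistances C ≠ ∅ ∧ TwoColored.blockColorSums C = Set.univ) := by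
  open TwoColored in
  have hzero := hC.zero_mem_blockColorSums
  have hneg := fun v => hC.neg_mem_blockColorSums (v := v)
  have hO : IsCaseO C → (sameColorDistances C ≠ ∅ → blockColorSums C = plusMinus {0, 2}) ∧
      (sameColorDistances C = ∅ → blockColorSums C = {0}) := by
    rintro ⟨hs, hf⟩
    refine ⟨fun hL => ?_, fun hL => ?_⟩
    · have h2 := hC.two_mem_blockColorSums hf hL
      refine Set.Subset.antisymm (fun v hv => ?_) ?_
      · rcases hC.eq_of_mem_blockColorSums hf hv with h | h | h
        · simp [plusMinus, h]
        · exact (hs h.2).elim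
        · rcases h.1 with h | h <;> simp [plusMinus, h]
      · rintro v ((rfl | rfl) | hv | hv)
        · exact hzero
        · exact h2
        · rwa [neg_eq_zero.1 hv]
        · rw [← neg_neg v, show -v = 2 from hv]
          exact hneg _ h2
    · refine Set.Subset.antisymm (fun v hv => ?_) (by rintro v rfl; exact hzero)
      rcases hC.eq_of_mem_blockColorSums hf hv with h | h | h
      · exact h
      · exact (hs h.2).elim
      · exact (h.2 hL).elim
  have hB : IsCaseB C → (sameColorDistances C ≠ ∅ → blockColorSums C = plusMinus {0, 1, 2}) ∧
      (sameColorDistances C = ∅ → blockColorSums C = plusMinus {0, 1}) := by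
    rintro ⟨hs, hf⟩
    have h1 := IsCategory.one_mem_blockColorSums hs
    refine ⟨fun hL => ?_, fun hL => ?_⟩
    · have h2 := hC.two_mem_blockColorSums hf hL
      refine Set.Subset.antisymm (fun v hv => ?_) ?_
      · rcases hC.eq_of_mem_blockColorSums hf hv with h | ⟨h | h, -⟩ | ⟨h | h, -⟩ <;>
          simp [plusMinus, h]
      · rintro v ((rfl | rfl | rfl) | hv | hv | hv)
        · exact hzero
        · exact h1
        · exact h2
        · rwa [neg_eq_zero.1 hv]
        · rw [← neg_neg v, hv]
          exact hneg _ h1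
        · rw [← neg_neg v, show -v = 2 from hv]
          exact hneg _ h2
    · refine Set.Subset.antisymm (fun v hv => ?_) ?_
      · rcases hC.eq_of_mem_blockColorSums hf hv with h | ⟨h | h, -⟩ | h
        · simp [plusMinus, h]
        · simp [plusMinus, h]
        · simp [plusMinus, h]
        · exact (h.2 hL).elim
      · rintro v ((rfl | rfl) | hv | hv)
        · exact hzero
        · exact h1
        · rwa [neg_eq_zero.1 hv]
        · rw [← neg_neg v, show -v = 1 from hv]
          exact hneg _ h1
  have hS : IsCaseS C → sameColorDistances C ≠ ∅ ∧ blockColorSums C = Set.univ :=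
    fun h => ⟨hC.sameColorDistances_ne_empty h.1 h.2, hC.blockColorSums_eq_univ h.1 h.2⟩
  refine ⟨?_, hO, hB, hS⟩
  by_cases hs : RowPart.singletons.bundle ∈ C
  · by_cases hf : RowPart.fourBlock.bundle ∈ C
    · exact .inr (.inr (.inr (.inr (hS ⟨hs, hf⟩).2)))
    · by_cases hL : sameColorDistances C = ∅
      · exact .inr (.inr (.inl ((hB ⟨hs, hf⟩).2 hL)))
      · exact .inr (.inr (.inr (.inl ((hB ⟨hs, hf⟩).1 hL))))
  · have hf : RowPart.fourBlock.bundle ∉ C := hN.resolve_left hs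
    by_cases hL : sameColorDistances C = ∅
    · exact .inl ((hO ⟨hs, hf⟩).2 hL)
    · exact .inr (.inl ((hO ⟨hs, hf⟩).1 hL))
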